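/- Let $X$ be an infinite-dimensional complex Banach space and let $T$ be a bounded linear operator on $X$. Denote by $\sigma(T)$ the spectrum of $T$, by $\sigma_p(T)$ the set of eigenvalues of $T$, and by $\sigma_a(T)$ the approximate point spectrum of $T$, i.e. the set of $\lambda\in\mathbb{C}$ for which $T-\lambda I$ is not bounded below. For $A\subset\mathbb{C}$ let $\operatorname{iso}A$ be the set of isolated points of $A$, and put \[E(T)=\operatorname{iso}\sigma(T)\cap\sigma_p(T),\qquad E_a(T)=\operatorname{iso}\sigma_a(T)\cap\sigma_p(T).\] A bounded operator $S$ on $X$ is Fredholm if its kernel is finite-dimensional and its range is closed and of finite codimension; it is Weyl if moreover $\dim\ker S=\operatorname{codim}\mathcal R(S)$. Let $\sigma_W(T)=\{\lambda\in\mathbb{C}: T-\lambda I\text{ is not Weyl}\}$. The ascent of $S$ is $a(S)=\inf\{n\in\mathbb{N}:\ker S^n=\ker S^{n+1}\}$, where $\mathbb{N}=\{0,1,2,\dots\}$ and $\inf\emptyset=\infty$. Let $\Pi_a(T)$ be the set of left poles of $T$, i.e. of all $\lambda\in\sigma_a(T)$ such that $a(T-\lambda I)<\infty$ and the range of $(T-\lambda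 I)^{a(T-\lambda I)+1}$ is closed. Say that $T$ has property $(Z_{E_a})$ if $\sigma(T)\setminus\sigma_W(T)=E_a(T)$, property $(Z_{\Pi_a})$ if $\sigma(T)\setminus\sigma_W(T)=\Pi_a(T)$, and property $(k)$ if $\sigma(T)\setminus\sigma_W(T)=E(T)$. Then the following statements are equivalent: (i) $T$ has property $(Z_{E_a})$; (ii) $T$ has property $(Z_{\Pi_a})$ and $E_a(T)=\Pi_a(T)$; (iii) $T$ has property $(k)$ and $E_a(T)=E(T)$. -/

import Mathlib

open Topology Filter

namespace WeylType

variable {X : Type*} [NormedAddCommGroup X] [NormedSpace ℂ X]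

/-- The isolated points of a subset of `ℂ`: the points of the set that are not accumulation
points of it. -/
def iso (A : Set ℂ) : Set ℂ := {μ | μ ∈ A ∧ ¬ AccPt μ (𝓟 A)}

/-- A Weyl operator: a Fredholm operator of index `0`, where
`index = dim ker - dim coker`. -/
def IsWeyl (S : X →L[ℂ] X) : Prop :=
  S.IsFredholm ∧ (S : X →ₗ[ℂ] X).index = 0

/-- The Weyl spectrum `σ_W(T)`. -/
def weylSpectrum (T : X →L[ℂ] X) : Set ℂ :=
  {μ | ¬ IsWeyl (T - μ • (1 : X →L[ℂ] X))}

/-- The approximate point spectrum `σ_a(T)`: those `μ` for which `T - μ` is not bounded below. -/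
def approxPointSpectrum (T : X →L[ℂ] X) : Set ℂ :=
  {μ | ¬ ∃ c : ℝ, 0 < c ∧ ∀ x : X, c * ‖x‖ ≤ ‖(T - μ • (1 : X →L[ℂ] X)) x‖}

/-- The set `σ_p(T)` of eigenvalues of `T`. -/
def pointSpectrum (T : X →L[ℂ] X) : Set ℂ :=
  {μ | Module.End.HasEigenvalue (T : X →ₗ[ℂ] X) μ}

/-- The ascent `inf {n ∈ ℕ : N(Sⁿ) = N(Sⁿ⁺¹)}`, with `inf ∅ = ∞`. -/
noncomputable def ascent (S : X →L[ℂ] X) : ℕ∞ :=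
  sInf ((fun n : ℕ => (n : ℕ∞)) '' {n : ℕ | (S ^ n).ker = (S ^ (n + 1)).ker})

/-- `E(T) = iso σ(T) ∩ σ_p(T)`. -/
def E (T : X →L[ℂ] X) : Set ℂ := iso (spectrum ℂ T) ∩ pointSpectrum T

/-- `E_a(T) = iso σ_a(T) ∩ σ_p(T)`. -/
def Ea (T : X →L[ℂ] X) : Set ℂ := iso (approxPointSpectrum T) ∩ pointSpectrum T

/-- The set `Π_a(T)` of left poles of `T`: those `μ ∈ σ_a(T)` such that `T - μ` has finite
ascent `p` and `(T - μ)ᵖ⁺¹` has closed range. -/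
def leftPoles (T : X →L[ℂ] X) : Set ℂ :=
  {μ | μ ∈ approxPointSpectrum T ∧
    ∃ p : ℕ, ascent (T - μ • (1 : X →L[ℂ] X)) = (p : ℕ∞) ∧
      IsClosed (Set.range ((T - μ • (1 : X →L[ℂ] X)) ^ (p + 1)))}

/-- Property `(Z_{E_a})`. -/
def PropertyZEa (T : X →L[ℂ] X) : Prop := spectrum ℂ T \ weylSpectrum T = Ea T

/-- Property `(Z_{Π_a})`. -/
def PropertyZPia (T : X →L[ℂ] X) : Prop := spectrum ℂ T \ weylSpectrum T = leftPoles T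

/-- Property `(k)`. -/
def PropertyK (T : X →L[ℂ] X) : Prop := spectrum ℂ T \ weylSpectrum T = E T

end WeylType

/-! (ii) and (iii) give (i) by substitution. Conversely, (i) makes `T - μ` Weyl at every `μ ∈ Ea T`,
and such a `μ` must be shown to be a left pole and isolated in the spectrum; `leftPoles T ⊆ Ea T`
and `E T ⊆ Ea T` always hold. Left pole: a Fredholm operator of infinite ascent has every small `z`
as an eigenvalue (`IsFredholm.exists_apply_eq_smul`), contradicting isolation in the approximate
point spectrum; powers of Fredholm operators have closed range. Isolated in the spectrum: a Weyl
operator is invertible modulo compacts, so by the Fredholm alternative its small shifts are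
invertible once injective (`IsWeyl.exists_isUnit_of_injective`). -/

namespace ContinuousLinearMap

variable {X : Type*} [NormedAddCommGroup X] [NormedSpace ℂ X] [CompleteSpace X]

/-- An operator with closed range admits preimages of controlled norm. -/
theorem exists_preimage_norm_le_of_isClosed_range {A : X →L[ℂ] X}
    (hA : IsClosed (Set.range A)) :
    ∃ C > 0, ∀ x, ∃ x', A x' = A x ∧ ‖x'‖ ≤ C * ‖A x‖ := by
  have hc : IsClosed (A.range : Set X) := by rwa [LinearMap.coe_range]
  have : CompleteSpace A.range := hc.completeSpace_coe
  obtain ⟨C, hC, h⟩ := ContinuousLinearMap.exists_preimage_norm_le A.rangeRestrict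
    (by
      rintro ⟨y, x, hx⟩
      exact ⟨x, Subtype.ext hx⟩)
  refine ⟨C, hC, fun x => ?_⟩
  obtain ⟨x', h1, h2⟩ := h ⟨A x, x, rfl⟩
  exact ⟨x', congrArg Subtype.val h1, h2⟩

/-- If the kernels of `S ^ p` and `S ^ (p + 1)` agree and `S ^ (p + 1)` has closed range, then
`S - z` is bounded below for all small nonzero `z`. -/
theorem exists_bounded_below_of_ker_pow_eq {S : X →L[ℂ] X} {p : ℕ}
    (hker : (S ^ p).ker = (S ^ (p + 1)).ker) (hclosed : IsClosed (Set.range (S ^ (p + 1)))) :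
    ∃ ε > 0, ∀ z : ℂ, z ≠ 0 → ‖z‖ < ε →
      ∃ c : ℝ, 0 < c ∧ ∀ x, c * ‖x‖ ≤ ‖(S - z • (1 : X →L[ℂ] X)) x‖ := by
  obtain ⟨C, hC, h⟩ := exists_preimage_norm_le_of_isClosed_range hclosed
  -- A controlled preimage of `(S ^ (p + 1)) x` differs from `x` by an element of `ker S ^ (p + 1) =
  -- ker S ^ p`.
  have hK : ∀ x, ‖(S ^ p) x‖ ≤ ‖S ^ p‖ * C * ‖(S ^ (p + 1)) x‖ := by
    intro x
    obtain ⟨x', h1, h2⟩ := h x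
    have h3 : x - x' ∈ (S ^ p).ker := by
      rw [hker]
      exact LinearMap.sub_mem_ker_iff.2 h1.symm
    have h4 : (S ^ p) x = (S ^ p) x' := LinearMap.sub_mem_ker_iff.1 h3
    rw [h4, mul_assoc]
    exact ((S ^ p).le_opNorm x').trans (by gcongr)
  set K := ‖S ^ p‖ * C with hKdef
  have hK0 : 0 ≤ K := by positivity
  -- This radius gives `K‖z‖ ≤ 1/2`, so the term `K‖z‖‖S ^ p x‖` below can be absorbed.
  refine ⟨1 / (2 * (K + 1)), by positivity, fun z hz hzε => ?_⟩
  set A := S - z • (1 : X →L[ℂ] X) with hAdef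
  have hKz : K * ‖z‖ ≤ 1 / 2 := by
    rw [lt_div_iff₀ (by positivity)] at hzε
    nlinarith [norm_nonneg z]
  have hSp : ∀ x, ‖(S ^ p) x‖ ≤ 2 * K * ‖S ^ p‖ * ‖A x‖ := by
    intro x
    have e : (S ^ (p + 1)) x = (S ^ p) (A x) + z • (S ^ p) x := by
      have hA : A x = S x - z • x := rfl
      rw [hA, map_sub, map_smul, sub_add_cancel, pow_succ]
      rfl
    have h1 : ‖(S ^ (p + 1)) x‖ ≤ ‖S ^ p‖ * ‖A x‖ + ‖z‖ * ‖(S ^ p) x‖ := by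
      rw [e]
      refine (norm_add_le _ _).trans ?_
      rw [norm_smul]
      gcongr
      exact (S ^ p).le_opNorm _
    have h2 := (hK x).trans (mul_le_mul_of_nonneg_left h1 hK0)
    have h3 := mul_le_mul_of_nonneg_right hKz (norm_nonneg ((S ^ p) x))
    nlinarith
  -- `S - z` divides `S ^ p - z ^ p`, so `z ^ p • x` is controlled by `S ^ p x` and `A x`.
  obtain ⟨q, hq⟩ : ∃ q : X →L[ℂ] X, q * A = S ^ p - z ^ p • (1 : X →L[ℂ] X) := by
    have hcomm : Commute S (z • (1 : X →L[ℂ] X)) := (Commute.one_right S).smul_right z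
    exact ⟨_, by rw [hAdef, hcomm.geom_sum₂_mul, smul_pow, one_pow]⟩
  set D := 2 * K * ‖S ^ p‖ + ‖q‖ with hD
  have hD0 : 0 ≤ D := by positivity
  refine ⟨‖z‖ ^ p / (D + 1), by positivity, fun x => ?_⟩
  have e : z ^ p • x = (S ^ p) x - q (A x) := by
    have hqx : q (A x) = (S ^ p) x - z ^ p • x := congrArg (fun B : X →L[ℂ] X => B x) hq
    rw [hqx, sub_sub_cancel]
  have h1 : ‖z‖ ^ p * ‖x‖ ≤ D * ‖A x‖ := by
    rw [← norm_pow, ← norm_smul, e, hD, add_mul]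
    exact (norm_sub_le _ _).trans (add_le_add (hSp x) (q.le_opNorm _))
  rw [div_mul_eq_mul_div, div_le_iff₀ (by positivity)]
  nlinarith [norm_nonneg (A x)]

/-- A surjective operator with nontrivial kernel has all small `z` as eigenvalues. -/
theorem exists_apply_eq_smul_of_surjective {A : X →L[ℂ] X} (hA : Function.Surjective A)
    {x₀ : X} (hx₀ : x₀ ≠ 0) (hAx₀ : A x₀ = 0) :
    ∃ ε > 0, ∀ z : ℂ, ‖z‖ < ε → ∃ y, y ≠ 0 ∧ A y = z • y := by
  obtain ⟨C, hC, h⟩ := ContinuousLinearMap.exists_preimage_norm_le A hA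
  choose g hg hgn using h
  refine ⟨1 / (2 * C), by positivity, fun z hz => ?_⟩
  rw [lt_div_iff₀ (by positivity)] at hz
  have hbound : ∀ k, ‖g^[k] x₀‖ ≤ C ^ k * ‖x₀‖ := by
    intro k
    induction k with
    | zero => simp
    | succ k ih =>
      rw [Function.iterate_succ_apply']
      refine (hgn _).trans ?_
      rw [pow_succ', mul_assoc]
      gcongr
  set r := C * ‖z‖ with hr
  have hr0 : 0 ≤ r := by positivity
  have hr1 : r < 1 / 2 := by linarith
  -- The eigenvector is `∑ zᵏ gᵏ x₀`, with `g` a possibly nonlinear right inverse; `r < 1/2` keeps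
  -- the tail smaller than `x₀`, so the sum is nonzero.
  set f : ℕ → X := fun k => z ^ k • g^[k] x₀ with hf
  have hfn : ∀ k, ‖f k‖ ≤ r ^ k * ‖x₀‖ := by
    intro k
    rw [hf, hr, norm_smul, norm_pow, mul_pow]
    calc ‖z‖ ^ k * ‖g^[k] x₀‖ ≤ ‖z‖ ^ k * (C ^ k * ‖x₀‖) := by gcongr; exact hbound k
      _ = _ := by ring
  have hgeom := (hasSum_geometric_of_lt_one hr0 (by linarith)).mul_right ‖x₀‖
  have hsum : Summable f := hgeom.summable.of_norm_bounded hfn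
  have hsplit : ∑' k, f k = x₀ + ∑' k, f (k + 1) := by
    rw [hsum.tsum_eq_zero_add]; simp [hf]
  refine ⟨∑' k, f k, fun h0 => ?_, ?_⟩
  · have htail : ‖∑' k, f (k + 1)‖ ≤ (r * (1 - r)⁻¹) * ‖x₀‖ := by
      refine tsum_of_norm_bounded
        (((hasSum_geometric_of_lt_one hr0 (by linarith)).mul_left r).mul_right ‖x₀‖) fun k => ?_
      simpa [pow_succ'] using hfn (k + 1)
    rw [hsplit, add_eq_zero_iff_eq_neg] at h0
    have hlt : r * (1 - r)⁻¹ < 1 := by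
      rw [← div_eq_mul_inv, div_lt_one (by linarith)]; linarith
    have hpos := norm_pos_iff.2 hx₀
    have : ‖x₀‖ = ‖∑' k, f (k + 1)‖ := by rw [← norm_neg (∑' k, f (k + 1)), ← h0]
    nlinarith
  · rw [A.map_tsum hsum, (A.summable hsum).tsum_eq_zero_add, ← tsum_const_smul'' z]
    have hstep : ∀ k, A (f (k + 1)) = z • f k := by
      intro k
      simp only [hf, map_smul, Function.iterate_succ_apply', hg]
      rw [pow_succ', mul_smul]
    have hf0 : A (f 0) = 0 := by simp [hf, hAx₀]
    simp only [hstep, hf0, zero_add]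

/-! ### Fredholm and Weyl operators -/

omit [CompleteSpace X] in
theorem IsFredholm.pow {S : X →L[ℂ] X} (hS : S.IsFredholm) (n : ℕ) : (S ^ n).IsFredholm := by
  obtain ⟨v, hv⟩ := hS.exists_isQuasiInverse
  have key : ∃ w : X →L[ℂ] X, w.IsQuasiInverse (S ^ n : X →L[ℂ] X) := by
    induction n with
    | zero => exact ⟨1, (LinearEquiv.refl ℂ X).isQuasiInverse⟩
    | succ n ih =>
      obtain ⟨w, hw⟩ := ih
      refine ⟨v ∘L w, ?_⟩
      rw [pow_succ]
      exact hv.comp hw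
  obtain ⟨w, hw⟩ := key
  exact .of_isQuasiInverse hw

/-- If the kernels of the powers of a Fredholm operator `S` are strictly increasing, then all
small `z` are eigenvalues of `S`. -/
theorem IsFredholm.exists_apply_eq_smul {S : X →L[ℂ] X} (hS : S.IsFredholm)
    (hasc : ∀ n, (S ^ n).ker ≠ (S ^ (n + 1)).ker) :
    ∃ ε > 0, ∀ z : ℂ, ‖z‖ < ε → ∃ y, y ≠ 0 ∧ S y = z • y := by
  have := hS.finite_ker
  have hanti : ∀ {m n : ℕ}, m ≤ n → (S ^ n).range ≤ (S ^ m).range := by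
    rintro m n hmn _ ⟨x, rfl⟩
    obtain ⟨k, rfl⟩ := Nat.exists_eq_add_of_le hmn
    exact ⟨(S ^ k) x, by rw [pow_add]; rfl⟩
  -- The decreasing subspaces `ker S ∩ range (S ^ n)` stabilize because `ker S` is
  -- finite-dimensional.
  obtain ⟨N, hN⟩ : ∃ N, ∀ n ≥ N, ∀ x, S x = 0 → x ∈ (S ^ N).range → x ∈ (S ^ n).range := by
    let f : ℕ →o (Submodule ℂ S.ker)ᵒᵈ :=
      ⟨fun n => OrderDual.toDual ((S ^ n).range.comap S.ker.subtype), fun m n hmn =>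
        Submodule.comap_mono (hanti hmn)⟩
    obtain ⟨N, hN⟩ := IsArtinian.monotone_stabilizes f
    refine ⟨N, fun n hn x hx hxN => ?_⟩
    have h1 : (⟨x, hx⟩ : S.ker) ∈ (S ^ N).range.comap S.ker.subtype := hxN
    have h2 : (S ^ N).range.comap S.ker.subtype = (S ^ n).range.comap S.ker.subtype := hN n hn
    rw [h2] at h1
    exact h1
  -- On this closed subspace `S` will be surjective with nonzero kernel, so the series construction
  -- applies to the restriction.
  set M : Submodule ℂ X := ⨅ n, (S ^ n).range with hM
  have hmemM : ∀ {x}, x ∈ M ↔ ∀ n, x ∈ (S ^ n).range := by simp [hM, Submodule.mem_iInf]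
  have hkerM : ∀ {x}, S x = 0 → x ∈ (S ^ N).range → x ∈ M := by
    intro x hx hxN
    refine hmemM.2 fun n => ?_
    rcases le_total N n with h | h
    · exact hN n h x hx hxN
    · exact hanti h hxN
  have hMclosed : IsClosed (M : Set X) := by
    rw [hM, Submodule.coe_iInf]
    exact isClosed_iInter fun n => (hS.pow n).isClosed_range
  have : CompleteSpace M := hMclosed.completeSpace_coe
  have hmaps : ∀ x ∈ M, S x ∈ M := by
    intro x hx
    refine hmemM.2 fun n => ?_
    obtain ⟨y, rfl⟩ := hmemM.1 hx n
    refine ⟨S y, ?_⟩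
    change (S ^ n * S) y = (S * S ^ n) y
    rw [(Commute.refl S).pow_left n |>.eq]
  have hsurj : ∀ y ∈ M, ∃ x ∈ M, S x = y := by
    intro y hy
    have hpre : ∀ n, ∃ x ∈ (S ^ n).range, S x = y := by
      intro n
      obtain ⟨u, hu⟩ := hmemM.1 hy (n + 1)
      exact ⟨(S ^ n) u, ⟨u, rfl⟩, by rw [← hu, pow_succ']; rfl⟩
    obtain ⟨x, hx, hxy⟩ := hpre N
    refine ⟨x, hmemM.2 fun n => ?_, hxy⟩
    obtain ⟨x', hx', hxy'⟩ := hpre (max n N)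
    have h1 : x - x' ∈ M := hkerM (by simp [hxy, hxy'])
      (Submodule.sub_mem _ hx (hanti (le_max_right n N) hx'))
    have h2 := Submodule.add_mem _ (hmemM.1 h1 n) (hanti (le_max_left n N) hx')
    simpa using h2
  obtain ⟨x₀, hx₀M, hx₀, hSx₀⟩ : ∃ x ∈ M, x ≠ 0 ∧ S x = 0 := by
    have hle : (S ^ N).ker ≤ (S ^ (N + 1)).ker := by
      intro x hx
      have hx' : (S ^ N) x = 0 := hx
      change (S ^ (N + 1)) x = 0
      rw [pow_succ']
      exact (congrArg S hx').trans (map_zero S)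
    obtain ⟨u, hu, hu'⟩ := SetLike.exists_of_lt (lt_of_le_of_ne hle (hasc N))
    have hSu : S ((S ^ N) u) = 0 := by
      rw [pow_succ'] at hu
      exact hu
    exact ⟨(S ^ N) u, hkerM hSu ⟨u, rfl⟩, hu', hSu⟩
  let A : M →L[ℂ] M := (S ∘L M.subtypeL).codRestrict M fun x => hmaps x x.2
  obtain ⟨ε, hε, h⟩ := exists_apply_eq_smul_of_surjective (A := A) (x₀ := ⟨x₀, hx₀M⟩)
    (by
      rintro ⟨y, hy⟩
      obtain ⟨x, hx, hxy⟩ := hsurj y hy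
      exact ⟨⟨x, hx⟩, Subtype.ext hxy⟩)
    (by simpa [Subtype.ext_iff] using hx₀) (Subtype.ext hSx₀)
  refine ⟨ε, hε, fun z hz => ?_⟩
  obtain ⟨y, hy, hAy⟩ := h z hz
  exact ⟨y, by simpa using hy, congrArg Subtype.val hAy⟩

/-- A Weyl operator is the difference of an invertible operator and a compact operator. -/
theorem _root_.WeylType.IsWeyl.exists_isUnit_add {S : X →L[ℂ] X} (hS : WeylType.IsWeyl S) :
    ∃ F : X →L[ℂ] X, IsCompactOperator F ∧ IsUnit (S + F) := by
  obtain ⟨hF, hind⟩ := hS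
  have := hF.finite_ker
  have hco : FiniteDimensional ℂ (X ⧸ S.range) := hF.finite_coker
  obtain ⟨P, hP⟩ := hF.closedComplemented_ker
  obtain ⟨G, hG⟩ := Submodule.exists_isCompl S.range
  let eG := Submodule.quotientEquivOfIsCompl S.range G hG
  have : FiniteDimensional ℂ G := eG.finiteDimensional
  have hdim : Module.finrank ℂ S.ker = Module.finrank ℂ G := by
    rw [← eG.finrank_eq]
    rw [LinearMap.index_eq_finrank_sub] at hind
    omega
  let Φ : S.ker ≃L[ℂ] G := (LinearEquiv.ofFinrankEq S.ker G hdim).toContinuousLinearEquiv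
  -- Index zero lets this finite-rank map carry `ker S` isomorphically onto a complement of the
  -- range.
  let F : X →L[ℂ] X := G.subtypeL ∘L (Φ : S.ker →L[ℂ] G) ∘L P
  have hFx : ∀ x, F x = (Φ (P x) : X) := fun _ => rfl
  refine ⟨F, ?_, ContinuousLinearMap.isUnit_iff_bijective.2 ⟨?_, ?_⟩⟩
  · have hid : IsCompactOperator (Φ : S.ker →L[ℂ] G) := by
      have : ProperSpace S.ker := FiniteDimensional.proper ℂ S.ker
      exact isCompactOperator_of_locallyCompactSpace_dom _
    exact (hid.comp_clm P).clm_comp G.subtypeL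
  · rw [injective_iff_map_eq_zero]
    intro x hx
    have h1 : S x = -(Φ (P x) : X) := by
      rw [add_apply, hFx] at hx
      exact eq_neg_of_add_eq_zero_left hx
    have h2 : S x = 0 := by
      refine Submodule.disjoint_def.1 hG.disjoint _ ⟨x, rfl⟩ ?_
      rw [h1]
      exact G.neg_mem (Φ (P x)).2
    have h3 : P x = 0 := by
      rw [h2, eq_comm, neg_eq_zero] at h1
      simpa using h1
    have h4 := hP ⟨x, h2⟩
    rw [h3] at h4
    exact (congrArg Subtype.val h4).symm
  · intro y
    obtain ⟨a, ⟨u, rfl⟩, b, hb, rfl⟩ := Submodule.mem_sup.1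
      (hG.sup_eq_top.symm ▸ Submodule.mem_top : y ∈ S.range ⊔ G)
    let k : S.ker := Φ.symm ⟨b, hb⟩ - P u
    refine ⟨u + k, ?_⟩
    have hk : S (k : X) = 0 := k.2
    have hΦ : Φ (P (u + k)) = ⟨b, hb⟩ := by
      rw [map_add, hP k]
      simp [k]
    rw [add_apply, hFx, hΦ, map_add, hk, add_zero]
    rfl

/-- Small perturbations `S - z` of a Weyl operator are invertible as soon as they are
injective. -/
theorem _root_.WeylType.IsWeyl.exists_isUnit_of_injective {S : X →L[ℂ] X}
    (hS : WeylType.IsWeyl S) :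
    ∃ ε > 0, ∀ z : ℂ, ‖z‖ < ε →
      Function.Injective (S - z • (1 : X →L[ℂ] X)) → IsUnit (S - z • (1 : X →L[ℂ] X)) := by
  obtain ⟨F, hF, hV⟩ := hS.exists_isUnit_add
  have hnhds : ∀ᶠ z : ℂ in 𝓝 0, IsUnit (S + F - z • (1 : X →L[ℂ] X)) := by
    have hcont : Continuous fun z : ℂ => S + F - z • (1 : X →L[ℂ] X) := by fun_prop
    exact (Units.isOpen.preimage hcont).mem_nhds (by simpa using hV)
  obtain ⟨ε, hε, h⟩ := Metric.eventually_nhds_iff.1 hnhds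
  refine ⟨ε, hε, fun z hz hinj => ?_⟩
  obtain ⟨W, hW⟩ := h (by simpa using hz)
  -- Factoring out `W = S + F - z` leaves identity minus compact, to which the Fredholm alternative
  -- applies.
  have hS' : S - z • (1 : X →L[ℂ] X) = W * (1 - (↑W⁻¹ : X →L[ℂ] X) * F) := by
    rw [mul_sub, mul_one, Units.mul_inv_cancel_left, hW]; abel
  have hK : IsCompactOperator ((↑W⁻¹ : X →L[ℂ] X) * F) := hF.clm_comp _
  rw [hS']
  refine W.isUnit.mul ?_
  rcases hK.hasEigenvalue_or_mem_resolventSet one_ne_zero with h1 | h1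
  · obtain ⟨x, hx⟩ := h1.exists_hasEigenvector
    refine absurd (hinj (a₁ := x) (a₂ := 0) ?_) hx.2
    have : ((↑W⁻¹ : X →L[ℂ] X) * F) x = x := by simpa using hx.apply_eq_smul
    have h0 : (1 - (↑W⁻¹ : X →L[ℂ] X) * F) x = 0 := by
      rw [sub_apply, this]
      exact sub_self x
    rw [hS', map_zero]
    exact (congrArg (W : X →L[ℂ] X) h0).trans (map_zero _)
  · simpa [spectrum.mem_resolventSet_iff] using h1

end ContinuousLinearMap

/-! ### Spectra, isolated points and left poles -/

namespace WeylType

variable {X : Type*} [NormedAddCommGroup X] [NormedSpace ℂ X]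

theorem mem_iso_iff {A : Set ℂ} {μ : ℂ} :
    μ ∈ iso A ↔ μ ∈ A ∧ ∃ ε > 0, ∀ z : ℂ, z ≠ 0 → ‖z‖ < ε → μ + z ∉ A := by
  refine and_congr_right fun _ => ?_
  rw [accPt_iff_frequently_nhdsNE, Filter.not_frequently, eventually_nhdsWithin_iff,
    Metric.eventually_nhds_iff]
  refine exists_congr fun ε => and_congr_right fun _ => ⟨fun h z hz hzε => ?_, fun h y hy hyμ => ?_⟩
  · exact h (by simpa using hzε) (by simpa using hz)
  · have := h (y - μ) (sub_ne_zero.2 hyμ) (by simpa [dist_eq_norm] using hy)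
    rwa [add_sub_cancel] at this

theorem sub_add_smul_one (T : X →L[ℂ] X) (μ z : ℂ) :
    T - (μ + z) • (1 : X →L[ℂ] X) = T - μ • (1 : X →L[ℂ] X) - z • (1 : X →L[ℂ] X) := by
  rw [add_smul, sub_sub]

theorem mem_pointSpectrum_iff {T : X →L[ℂ] X} {μ : ℂ} :
    μ ∈ pointSpectrum T ↔ ¬ Function.Injective (T - μ • (1 : X →L[ℂ] X)) := by
  change Module.End.HasEigenvalue (T : X →ₗ[ℂ] X) μ ↔ _
  rw [Module.End.hasEigenvalue_iff, Module.End.eigenspace_def, not_iff_not,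
    LinearMap.ker_eq_bot]
  rfl

theorem mem_spectrum_iff {T : X →L[ℂ] X} {μ : ℂ} :
    μ ∈ spectrum ℂ T ↔ ¬ IsUnit (T - μ • (1 : X →L[ℂ] X)) := by
  rw [spectrum.mem_iff, Algebra.algebraMap_eq_smul_one, ← IsUnit.neg_iff, neg_sub]

theorem pointSpectrum_subset_approxPointSpectrum (T : X →L[ℂ] X) :
    pointSpectrum T ⊆ approxPointSpectrum T := by
  intro μ hμ
  rw [mem_pointSpectrum_iff] at hμ
  rintro ⟨c, hc, h⟩
  refine hμ ((injective_iff_map_eq_zero _).2 fun x hx => ?_)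
  have h1 := h x
  rw [hx, norm_zero] at h1
  exact norm_le_zero_iff.1 (nonpos_of_mul_nonpos_right h1 hc)

theorem approxPointSpectrum_subset_spectrum (T : X →L[ℂ] X) :
    approxPointSpectrum T ⊆ spectrum ℂ T := by
  intro μ hμ
  rw [mem_spectrum_iff]
  rintro ⟨U, hU⟩
  set B : X →L[ℂ] X := ↑U⁻¹ with hB
  refine hμ ⟨1 / (‖B‖ + 1), by positivity, fun x => ?_⟩
  have hx : B ((T - μ • (1 : X →L[ℂ] X)) x) = x := by
    rw [← hU]
    exact congrArg (fun A : X →L[ℂ] X => A x) U.inv_mul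
  rw [one_div, inv_mul_le_iff₀ (by positivity)]
  have h1 := B.le_opNorm ((T - μ • (1 : X →L[ℂ] X)) x)
  rw [hx] at h1
  nlinarith [norm_nonneg ((T - μ • (1 : X →L[ℂ] X)) x)]

theorem not_mem_approxPointSpectrum_injective {T : X →L[ℂ] X} {μ : ℂ}
    (h : μ ∉ approxPointSpectrum T) : Function.Injective (T - μ • (1 : X →L[ℂ] X)) :=
  not_not.1 fun hinj =>
    h (pointSpectrum_subset_approxPointSpectrum T (mem_pointSpectrum_iff.2 hinj))

theorem E_subset_Ea (T : X →L[ℂ] X) : E T ⊆ Ea T := by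
  rintro μ ⟨h1, h2⟩
  obtain ⟨-, ε, hε, h⟩ := mem_iso_iff.1 h1
  exact ⟨mem_iso_iff.2 ⟨pointSpectrum_subset_approxPointSpectrum T h2, ε, hε, fun z hz hzε hmem =>
    h z hz hzε (approxPointSpectrum_subset_spectrum T hmem)⟩, h2⟩

theorem exists_ascent_eq {S : X →L[ℂ] X} {n : ℕ} (hn : (S ^ n).ker = (S ^ (n + 1)).ker) :
    ∃ p : ℕ, ascent S = p := by
  refine (ENat.ne_top_iff_exists.1 (ne_top_of_le_ne_top (ENat.natCast_ne_top n) ?_)).imp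
    fun _ => Eq.symm
  exact sInf_le ⟨n, hn, rfl⟩

theorem ker_pow_eq_of_ascent_eq {S : X →L[ℂ] X} {p : ℕ} (hp : ascent S = p) :
    (S ^ p).ker = (S ^ (p + 1)).ker := by
  have hne : ((fun n : ℕ => (n : ℕ∞)) '' {n : ℕ | (S ^ n).ker = (S ^ (n + 1)).ker}).Nonempty := by
    by_contra h
    rw [Set.not_nonempty_iff_eq_empty] at h
    rw [ascent, h, sInf_empty] at hp
    exact ENat.natCast_ne_top p hp.symm
  obtain ⟨n, hn, hnp⟩ := csInf_mem hne
  have : n = p := Nat.cast_injective (R := ℕ∞) (hnp.trans hp)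
  exact this ▸ hn

variable [CompleteSpace X]

/-- Isolation comes from boundedness below of the small nonzero shifts. Were `T - μ` injective, its
power `p + 1`, having closed range, would be bounded below, hence so would `T - μ`. -/
theorem leftPoles_subset_Ea (T : X →L[ℂ] X) : leftPoles T ⊆ Ea T := by
  rintro μ ⟨hμ, p, hp, hclosed⟩
  have hker := ker_pow_eq_of_ascent_eq hp
  refine ⟨mem_iso_iff.2 ⟨hμ, ?_⟩, mem_pointSpectrum_iff.2 fun hinj => hμ ?_⟩
  · obtain ⟨ε, hε, h⟩ := ContinuousLinearMap.exists_bounded_below_of_ker_pow_eq hker hclosed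
    refine ⟨ε, hε, fun z hz hzε hmem => hmem ?_⟩
    rw [sub_add_smul_one]
    exact h z hz hzε
  · set S := T - μ • (1 : X →L[ℂ] X)
    obtain ⟨C, hC, h⟩ := ContinuousLinearMap.exists_preimage_norm_le_of_isClosed_range hclosed
    have hinj' : Function.Injective (S ^ (p + 1)) := by
      rw [FunLike.coe_pow_eq_iterate]
      exact hinj.iterate _
    refine ⟨1 / (C * ‖S ^ p‖ + 1), by positivity, fun x => ?_⟩
    rw [one_div, inv_mul_le_iff₀ (by positivity)]
    obtain ⟨x', hx', hn⟩ := h x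
    rw [hinj' hx'] at hn
    have h1 : ‖(S ^ (p + 1)) x‖ ≤ ‖S ^ p‖ * ‖S x‖ := by
      rw [pow_succ]
      exact (S ^ p).le_opNorm (S x)
    nlinarith [norm_nonneg (S x), mul_le_mul_of_nonneg_left h1 hC.le]

/-- If `T - μ` is Weyl and `μ` is isolated in the approximate point spectrum, then `μ` is
isolated in the spectrum. -/
theorem mem_iso_spectrum_of_isWeyl {T : X →L[ℂ] X} {μ : ℂ}
    (hW : IsWeyl (T - μ • (1 : X →L[ℂ] X))) (hμ : μ ∈ iso (approxPointSpectrum T)) :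
    μ ∈ iso (spectrum ℂ T) := by
  obtain ⟨hμa, ε, hε, h⟩ := mem_iso_iff.1 hμ
  obtain ⟨δ, hδ, h'⟩ := hW.exists_isUnit_of_injective
  refine mem_iso_iff.2 ⟨approxPointSpectrum_subset_spectrum T hμa, min ε δ, lt_min hε hδ,
    fun z hz hzε => ?_⟩
  rw [mem_spectrum_iff, not_not, sub_add_smul_one]
  refine h' z (hzε.trans_le (min_le_right _ _)) ?_
  rw [← sub_add_smul_one]
  exact not_mem_approxPointSpectrum_injective (h z hz (hzε.trans_le (min_le_left _ _)))

/-- If `T - μ` is Fredholm and `μ` is isolated in the approximate point spectrum, then `μ` is a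
left pole. -/
theorem mem_leftPoles_of_isFredholm {T : X →L[ℂ] X} {μ : ℂ}
    (hF : (T - μ • (1 : X →L[ℂ] X)).IsFredholm) (hμ : μ ∈ iso (approxPointSpectrum T)) :
    μ ∈ leftPoles T := by
  obtain ⟨hμa, ε, hε, h⟩ := mem_iso_iff.1 hμ
  obtain ⟨p, hp⟩ : ∃ p : ℕ, ascent (T - μ • (1 : X →L[ℂ] X)) = p := by
    by_contra hasc
    obtain ⟨δ, hδ, h'⟩ := hF.exists_apply_eq_smul fun n hn => hasc (exists_ascent_eq hn)
    obtain ⟨r, hr, hrlt⟩ := exists_between (lt_min hε hδ)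
    have hrn : ‖(r : ℂ)‖ = r := by rw [Complex.norm_real, Real.norm_of_nonneg hr.le]
    obtain ⟨y, hy, hSy⟩ := h' r (by rw [hrn]; exact hrlt.trans_le (min_le_right _ _))
    have hinj := not_mem_approxPointSpectrum_injective
      (h r (by exact_mod_cast hr.ne') (by rw [hrn]; exact hrlt.trans_le (min_le_left _ _)))
    refine hy (hinj (a₂ := 0) ?_)
    rw [sub_add_smul_one, map_zero, sub_apply, hSy]
    exact sub_self _
  refine ⟨hμa, p, hp, ?_⟩
  have := (hF.pow (p + 1)).isClosed_range
  rwa [LinearMap.coe_range] at this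

end WeylType

theorem mainTheorem11 {X : Type*} [NormedAddCommGroup X] [NormedSpace ℂ X] [CompleteSpace X]
    (hX : ¬ FiniteDimensional ℂ X) (T : X →L[ℂ] X) :
    [WeylType.PropertyZEa T,
      WeylType.PropertyZPia T ∧ WeylType.Ea T = WeylType.leftPoles T,
      WeylType.PropertyK T ∧ WeylType.Ea T = WeylType.E T].TFAE := by
  have key : WeylType.PropertyZEa T →
      WeylType.Ea T = WeylType.leftPoles T ∧ WeylType.Ea T = WeylType.E T := by
    intro h
    have hW : ∀ μ ∈ WeylType.Ea T, WeylType.IsWeyl (T - μ • (1 : X →L[ℂ] X)) := by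
      intro μ hμ
      rw [← h] at hμ
      exact not_not.1 hμ.2
    exact ⟨Set.Subset.antisymm
        (fun μ hμ => WeylType.mem_leftPoles_of_isFredholm (hW μ hμ).1 hμ.1)
        (WeylType.leftPoles_subset_Ea T),
      Set.Subset.antisymm
        (fun μ hμ => ⟨WeylType.mem_iso_spectrum_of_isWeyl (hW μ hμ) hμ.1, hμ.2⟩)
        (WeylType.E_subset_Ea T)⟩
  tfae_have 1 → 2 := fun h => ⟨h.trans (key h).1, (key h).1⟩
  tfae_have 2 → 1 := fun h => h.1.trans h.2.symm
  tfae_have 1 → 3 := fun h => ⟨h.trans (key h).2, (key h).2⟩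
  tfae_have 3 → 1 := fun h => h.1.trans h.2.symm
  tfae_finish
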